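/- Let $(\mathcal X,\mathcal W)$ be a measurable space with a probability measure $\mu$. For $1\le q\le\infty$ let $\overline{\mathbb L}_q$ be the set of all $t\in\mathbb L_q(\mu)$ with $t\ge 0$ and $\int t\,d\mu=1$, and let $d_2(t,u)=\|t-u\|_2$ be the distance of $\mathbb L_2(\mu)$. There is a function $C(A,q)$, with finite values and depending on nothing but $A$ and $q$, such that the following holds (for every such $(\mathcal X,\mathcal W,\mu)$). Let $n\ge 1$ be an integer, let $A\ge 1$ be a real number, and let $(t_i)_{i\ge1}$ be a sequence in $\overline{\mathbb L}_\infty$ with $\|t_i\|_\infty\le 2^{i+1}$ for every $i\ge1$. Then there is an estimator $\hat s_A=\hat s_A(X_1,\dots,X_n)$, that is, a (strongly) measurable map $\hat s_A:\mathcal X^n\to\mathbb L_2(\mu)$, such that for all $s\in\overline{\mathbb L}_2$ and all real $q$ with $1\le q<2A/\log 2$, $$\mathbb E_s\left[d_2^q(\hat s_A,s)\right]\le C(A,q)\,\inf_{i\ge1}\left[d_2(s,t_i)\vee\sqrt{\frac{i\,2^i}{n}}\,\right]^q ,$$ where $\mathbb E_s$ denotes the expectation when $X_1,\dots,X_n$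 are independent with density $s$ with respect to $\mu$, and $\log$ is the natural logarithm. The estimator depends on neither $s$ nor $q$. -/

import Mathlib

open MeasureTheory
open scoped ENNReal NNReal

universe u

noncomputable section

/-- The set `L̄_q` of the (classes of) functions of `L_q(μ)` that are probability densities
with respect to `μ`. -/
def Lbar {𝒳 : Type*} [MeasurableSpace 𝒳] (q : ℝ≥0∞) (μ : Measure 𝒳) : Set (𝒳 →ₘ[μ] ℝ) :=
  {t | t ∈ Lp ℝ q μ ∧ 0 ≤ t ∧ ∫ x, t x ∂μ = 1}

/-- The set `L̄_∞^Γ` of the densities in `L̄_∞` with `‖t‖_∞ ≤ Γ`. -/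
def LbarInfty {𝒳 : Type*} [MeasurableSpace 𝒳] (Γ : ℝ) (μ : Measure 𝒳) : Set (𝒳 →ₘ[μ] ℝ) :=
  {t | t ∈ Lbar ∞ μ ∧ eLpNorm t ∞ μ ≤ ENNReal.ofReal Γ}

/-- The distance `d₂(t, u) = ‖t - u‖` of `L_2(μ)`, as an extended nonnegative number
(it is finite on `L_2(μ)`). -/
def d2 {𝒳 : Type*} [MeasurableSpace 𝒳] {μ : Measure 𝒳} (t u : 𝒳 →ₘ[μ] ℝ) : ℝ≥0∞ :=
  eLpNorm (t - u : 𝒳 →ₘ[μ] ℝ) 2 μ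

/-- The distribution `P_s = s · μ`. -/
def densityLaw {𝒳 : Type*} [MeasurableSpace 𝒳] {μ : Measure 𝒳} (s : 𝒳 →ₘ[μ] ℝ) : Measure 𝒳 :=
  μ.withDensity (fun x => ENNReal.ofReal (s x))

/-- The distribution `P_s^{⊗n}` of an i.i.d. sample of size `n` from `P_s`. -/
def sampleLaw {𝒳 : Type*} [MeasurableSpace 𝒳] {μ : Measure 𝒳} (n : ℕ) (s : 𝒳 →ₘ[μ] ℝ) :
    Measure (Fin n → 𝒳) :=
  Measure.pi (fun _ : Fin n => densityLaw s)

/-- The risk `E_s [d₂(ŝ(X), s)^q]` at `s` of an estimator `ŝ` with values in `L_2(μ)`, where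
`X` has distribution `P_s^{⊗n}`. -/
def risk {𝒳 : Type*} [MeasurableSpace 𝒳] {μ : Measure 𝒳} {n : ℕ} (q : ℝ)
    (shat : (Fin n → 𝒳) → Lp ℝ 2 μ) (s : 𝒳 →ₘ[μ] ℝ) : ℝ≥0∞ :=
  ∫⁻ x, d2 (shat x : 𝒳 →ₘ[μ] ℝ) s ^ q ∂(sampleLaw n s)

end

/-! The estimator minimises, over `1 ≤ j ≤ n`, the unbiased estimate `‖t_j‖² - (2/n) ∑ t_j(X_k)` of
`‖s - t_j‖² - ‖s‖²` plus the penalty `192 A j 2^j / n`. Fix an oracle `i`. By a Bernstein bound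
(`sampleLaw_criterion_le_criterion`), a `j` with `t_j` far from `t_i` beats `i` only with
exponentially small probability. The noise level is of order `2^(max i j) / n`, so the `q`-th moment
of the loss costs a factor `2^(q max(i,j) / 2)`. The penalty of `j`, or the distance itself when `j
< i`, outweighs this factor since `q log 2 < 2A`, and leaves a summable `e^(-j)`
(`rpow_mul_exp_criterion_le`, `lintegral_argmin_le`). An oracle `i > n` need not be a candidate: its
term `i 2^i / n ≥ 2^i` dominates the squared norms of `t_i` and `t_1`, so index `1` does as well up
to a factor 5. -/

/-- Chernoff's bound of Bernstein type for a sum of independent bounded variables. -/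
theorem measureReal_pi_le_sum_le_exp {𝒳 : Type*} [MeasurableSpace 𝒳] (P : Measure 𝒳)
    [IsProbabilityMeasure P] {Y : 𝒳 → ℝ} (hY : Measurable Y) {b l : ℝ} (hb : ∀ x, |Y x| ≤ b)
    (hl : 0 ≤ l) (hlb : l * b ≤ 1) (n : ℕ) (z : ℝ) :
    (Measure.pi (fun _ : Fin n => P)).real {x | n * z ≤ ∑ k, Y (x k)} ≤
      Real.exp (-(n * l * (z - ∫ x, Y x ∂P - l * ∫ x, Y x ^ 2 ∂P))) := by
  have hlY : ∀ x, |l * Y x| ≤ 1 := fun x => by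
    rw [abs_mul, abs_of_nonneg hl]
    exact (mul_le_mul_of_nonneg_left (hb x) hl).trans hlb
  have hsum : ∀ x : Fin n → 𝒳, |∑ k, Y (x k)| ≤ n * b := fun x =>
    (Finset.abs_sum_le_sum_abs _ _).trans
      ((Finset.sum_le_sum fun k _ => hb (x k)).trans (by simp))
  have hsm : Measurable fun x : Fin n → 𝒳 => ∑ k, Y (x k) := by fun_prop
  have hint : Integrable (fun x : Fin n → 𝒳 => Real.exp (l * ∑ k, Y (x k)))
      (Measure.pi (fun _ : Fin n => P)) := by
    refine Integrable.of_bound (by exact (hsm.const_mul l).exp.aestronglyMeasurable)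
      (Real.exp (l * (n * b))) (.of_forall fun x => ?_)
    rw [Real.norm_eq_abs, Real.abs_exp, Real.exp_le_exp]
    exact mul_le_mul_of_nonneg_left ((le_abs_self _).trans (hsum x)) hl
  have hYi : Integrable Y P :=
    Integrable.of_bound (by fun_prop) b (.of_forall fun x => by simpa using hb x)
  have hY2i : Integrable (fun x => Y x ^ 2) P :=
    Integrable.of_bound (by fun_prop) (b ^ 2) (.of_forall fun x => by
      rw [Real.norm_eq_abs, abs_pow]
      exact pow_le_pow_left₀ (abs_nonneg _) (hb x) 2)
  have hEi : Integrable (fun x => Real.exp (l * Y x)) P :=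
    Integrable.of_bound (by fun_prop) (Real.exp 1) (.of_forall fun x => by
      rw [Real.norm_eq_abs, Real.abs_exp, Real.exp_le_exp]
      exact (le_abs_self _).trans (hlY x))
  have hone : ∫ x, Real.exp (l * Y x) ∂P ≤
      Real.exp (l * ∫ x, Y x ∂P + l ^ 2 * ∫ x, Y x ^ 2 ∂P) := by
    calc ∫ x, Real.exp (l * Y x) ∂P ≤ ∫ x, (1 + (l * Y x + l ^ 2 * Y x ^ 2)) ∂P := by
          refine integral_mono hEi ((integrable_const _).add
            ((hYi.const_mul l).add (hY2i.const_mul _))) fun x => ?_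
          -- `e^u ≤ 1 + u + u²` for `|u| ≤ 1`; this is where `l * b ≤ 1` is used.
          have := (abs_le.1 (Real.abs_exp_sub_one_sub_id_le (hlY x))).2
          rw [mul_pow] at this
          dsimp only
          linarith
      _ = (l * ∫ x, Y x ∂P + l ^ 2 * ∫ x, Y x ^ 2 ∂P) + 1 := by
          have h := (hYi.const_mul l).add (hY2i.const_mul (l ^ 2))
          rw [integral_add (integrable_const _) (by exact h),
            integral_add (hYi.const_mul l) (hY2i.const_mul _), integral_const_mul,
            integral_const_mul]
          simp [add_comm]
      _ ≤ _ := Real.add_one_le_exp _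
  have hmgf : ProbabilityTheory.mgf (fun x : Fin n → 𝒳 => ∑ k, Y (x k))
      (Measure.pi (fun _ : Fin n => P)) l = (∫ x, Real.exp (l * Y x) ∂P) ^ n := by
    simp only [ProbabilityTheory.mgf, Finset.mul_sum, Real.exp_sum]
    rw [integral_fintype_prod_eq_prod (fun (_ : Fin n) x => Real.exp (l * Y x))]
    simp
  refine (ProbabilityTheory.measure_ge_le_exp_mul_mgf (n * z) hl hint).trans ?_
  rw [hmgf]
  calc Real.exp (-l * (n * z)) * (∫ x, Real.exp (l * Y x) ∂P) ^ n
      ≤ Real.exp (-l * (n * z)) *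
        Real.exp (l * ∫ x, Y x ∂P + l ^ 2 * ∫ x, Y x ^ 2 ∂P) ^ n := by gcongr
    _ = _ := by
      rw [← Real.exp_nat_mul, ← Real.exp_add]
      congr 1
      ring

/-! ### Densities and their laws -/

theorem ae_nonneg_of_nonneg {𝒳 : Type*} [MeasurableSpace 𝒳] {μ : Measure 𝒳} {s : 𝒳 →ₘ[μ] ℝ}
    (hs : 0 ≤ s) : 0 ≤ᵐ[μ] s := by
  filter_upwards [AEEqFun.coeFn_le.2 hs, AEEqFun.coeFn_zero (α := 𝒳) (β := ℝ) (μ := μ)]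
    with x h1 h2
  rwa [h2] at h1

theorem isProbabilityMeasure_densityLaw {𝒳 : Type*} [MeasurableSpace 𝒳] {μ : Measure 𝒳}
    [IsProbabilityMeasure μ] {s : 𝒳 →ₘ[μ] ℝ} (hs : s ∈ Lbar 2 μ) :
    IsProbabilityMeasure (densityLaw s) := by
  obtain ⟨h2, h0, h1⟩ := hs
  have hi : Integrable s μ := ((Lp.mem_Lp_iff_memLp.1 h2)).integrable (by norm_num)
  refine ⟨?_⟩
  rw [densityLaw, withDensity_apply _ MeasurableSet.univ, Measure.restrict_univ,
    ← ofReal_integral_eq_lintegral_ofReal hi (ae_nonneg_of_nonneg h0), h1,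
    ENNReal.ofReal_one]

theorem integral_densityLaw {𝒳 : Type*} [MeasurableSpace 𝒳] {μ : Measure 𝒳}
    [IsProbabilityMeasure μ] {s : 𝒳 →ₘ[μ] ℝ} (hs : 0 ≤ s) (g : 𝒳 → ℝ) :
    ∫ x, g x ∂(densityLaw s) = ∫ x, s x * g x ∂μ := by
  rw [densityLaw, integral_withDensity_eq_integral_toReal_smul (by
    exact s.measurable.ennreal_ofReal) (by simp)]
  refine integral_congr_ae ?_
  filter_upwards [ae_nonneg_of_nonneg hs] with x hx
  simp [ENNReal.toReal_ofReal hx]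

theorem Lp_two_norm_sq_eq {𝒳 : Type*} [MeasurableSpace 𝒳] {μ : Measure 𝒳} (F : Lp ℝ 2 μ) :
    ‖F‖ ^ 2 = ∫ x, F x ^ 2 ∂μ := by
  rw [← real_inner_self_eq_norm_sq, L2.inner_def]
  simp [sq]

/-! ### Pairwise comparison of candidates -/

/-- The least squares comparison of two bounded candidates `f` and `g` with a penalty `c`. -/
theorem sampleLaw_criterion_le_criterion {𝒳 : Type*} [MeasurableSpace 𝒳] {μ : Measure 𝒳}
    [IsProbabilityMeasure μ] {S F G : Lp ℝ 2 μ} (hs : (S : 𝒳 →ₘ[μ] ℝ) ∈ Lbar 2 μ)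
    {f g : 𝒳 → ℝ} (hf : Measurable f) (hg : Measurable g) (hFf : F =ᵐ[μ] f) (hGg : G =ᵐ[μ] g)
    {b : ℝ} (hb : 0 < b) (hf0 : ∀ x, 0 ≤ f x) (hfb : ∀ x, f x ≤ b) (hg0 : ∀ x, 0 ≤ g x)
    (hgb : ∀ x, g x ≤ b) {n : ℕ} (hn : 1 ≤ n) (c : ℝ) :
    (sampleLaw n (S : 𝒳 →ₘ[μ] ℝ)).real
      {x | ‖G‖ ^ 2 - 2 / n * ∑ k, g (x k) + c ≤ ‖F‖ ^ 2 - 2 / n * ∑ k, f (x k)} ≤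
      Real.exp (-(n / (12 * b) * (‖G - F‖ ^ 2 / 8 - 2 * ‖S - F‖ ^ 2 + c / 2))) := by
  have := isProbabilityMeasure_densityLaw hs
  have hn' : (0 : ℝ) < n := by exact_mod_cast hn
  set Y : 𝒳 → ℝ := fun x => g x - f x with hYdef
  have hY : Measurable Y := hg.sub hf
  have hYb : ∀ x, |Y x| ≤ b := fun x => by
    rw [abs_le]
    constructor <;> simp only [hYdef] <;> linarith [hf0 x, hfb x, hg0 x, hgb x]
  have hYae : (G - F : Lp ℝ 2 μ) =ᵐ[μ] Y := by
    filter_upwards [Lp.coeFn_sub G F, hFf, hGg] with x h1 h2 h3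
    rw [h1, Pi.sub_apply, h2, h3]
  have hEY : ∫ x, Y x ∂(densityLaw (S : 𝒳 →ₘ[μ] ℝ)) = inner ℝ S (G - F) := by
    rw [integral_densityLaw hs.2.1, L2.inner_def]
    refine integral_congr_ae ?_
    filter_upwards [hYae] with x hx
    rw [hx]
    simp [mul_comm]
  -- `S` is only in `L_2`, so it cannot be bounded pointwise. In `S = f + u`, the part `f Y²` uses
  -- `f ≤ b`, and `u Y · Y` uses `|Y| ≤ b` with `|u Y| ≤ (u² + Y²) / 2`.
  have hEY2 : ∫ x, Y x ^ 2 ∂(densityLaw (S : 𝒳 →ₘ[μ] ℝ)) ≤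
      b * (3 / 2 * ‖G - F‖ ^ 2 + 1 / 2 * ‖S - F‖ ^ 2) := by
    rw [integral_densityLaw hs.2.1, Lp_two_norm_sq_eq, Lp_two_norm_sq_eq, ← integral_const_mul,
      ← integral_const_mul, ← integral_add ((Lp.memLp _).integrable_sq.const_mul _)
        ((Lp.memLp _).integrable_sq.const_mul _), ← integral_const_mul]
    refine integral_mono_of_nonneg ?_ ((((Lp.memLp _).integrable_sq.const_mul _).add
        ((Lp.memLp _).integrable_sq.const_mul _)).const_mul _) ?_
    · filter_upwards [ae_nonneg_of_nonneg hs.2.1] with x hx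
      exact mul_nonneg hx (sq_nonneg _)
    · filter_upwards [hYae, hFf, Lp.coeFn_sub S F] with x h1 h2 h3
      simp only [h1, h3, Pi.sub_apply, h2]
      set u := S x - f x
      have hS : S x = f x + u := by simp [u]
      have h4 : u * Y x ≤ (u ^ 2 + Y x ^ 2) / 2 := by nlinarith [sq_nonneg (u - Y x)]
      have h4' : -(u * Y x) ≤ (u ^ 2 + Y x ^ 2) / 2 := by nlinarith [sq_nonneg (u + Y x)]
      have h5 : u * Y x * Y x ≤ (u ^ 2 + Y x ^ 2) / 2 * b := by
        calc u * Y x * Y x ≤ |u * Y x * Y x| := le_abs_self _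
          _ = |u * Y x| * |Y x| := abs_mul _ _
          _ ≤ _ := mul_le_mul (abs_le'.2 ⟨h4, h4'⟩) (hYb x) (abs_nonneg _) (by positivity)
      have h6 : f x * Y x ^ 2 ≤ b * Y x ^ 2 := mul_le_mul_of_nonneg_right (hfb x) (sq_nonneg _)
      change S x * Y x ^ 2 ≤ _
      rw [hS]
      linarith
  have hkey : inner ℝ S (G - F) =
      (‖G‖ ^ 2 - ‖F‖ ^ 2 + ‖S - F‖ ^ 2 - ‖S - G‖ ^ 2) / 2 := by
    rw [inner_sub_right, @norm_sub_sq_real _ _ _ S F, @norm_sub_sq_real _ _ _ S G]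
    ring
  have htri : ‖G - F‖ ^ 2 ≤ 2 * ‖S - G‖ ^ 2 + 2 * ‖S - F‖ ^ 2 := by
    have h : ‖G - F‖ ≤ ‖S - G‖ + ‖S - F‖ := by
      rw [norm_sub_rev S G]
      calc ‖G - F‖ = ‖(G - S) + (S - F)‖ := by congr 1; abel
        _ ≤ _ := norm_add_le _ _
    nlinarith [norm_nonneg (G - F), sq_nonneg (‖S - G‖ - ‖S - F‖)]
  set z : ℝ := (‖G‖ ^ 2 - ‖F‖ ^ 2 + c) / 2 with hz
  have hset : {x : Fin n → 𝒳 |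
      ‖G‖ ^ 2 - 2 / n * ∑ k, g (x k) + c ≤ ‖F‖ ^ 2 - 2 / n * ∑ k, f (x k)} =
      {x | n * z ≤ ∑ k, Y (x k)} := by
    ext x
    simp only [Set.mem_ofPred_eq, hYdef, Finset.sum_sub_distrib, hz]
    rw [← sub_nonneg, ← sub_nonneg (b := (n : ℝ) * _)]
    have : ∑ k, g (x k) - ∑ k, f (x k) - n * ((‖G‖ ^ 2 - ‖F‖ ^ 2 + c) / 2) =
        n / 2 * (‖F‖ ^ 2 - 2 / n * ∑ k, f (x k) -
          (‖G‖ ^ 2 - 2 / n * ∑ k, g (x k) + c)) := by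
      field_simp
      ring
    rw [this, mul_nonneg_iff_of_pos_left (by positivity)]
  rw [hset, sampleLaw]
  -- By `hkey` and `htri` the drift gains `‖G - F‖² / 4`; with `l = 1 / (12 b)` the second moment
  -- takes back only half of it.
  refine (measureReal_pi_le_sum_le_exp (densityLaw (S : 𝒳 →ₘ[μ] ℝ)) hY (l := 1 / (12 * b)) hYb
    (by positivity) (by field_simp; norm_num) n z).trans ?_
  rw [Real.exp_le_exp, neg_le_neg_iff, hEY, hkey]
  have h1 : 1 / (12 * b) * ∫ x, Y x ^ 2 ∂(densityLaw (S : 𝒳 →ₘ[μ] ℝ)) ≤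
      (3 / 2 * ‖G - F‖ ^ 2 + 1 / 2 * ‖S - F‖ ^ 2) / 12 := by
    calc _ ≤ 1 / (12 * b) * (b * (3 / 2 * ‖G - F‖ ^ 2 + 1 / 2 * ‖S - F‖ ^ 2)) := by gcongr
      _ = _ := by field_simp
  have h2 : (n : ℝ) * (1 / (12 * b)) = n / (12 * b) := by ring
  rw [h2]
  refine mul_le_mul_of_nonneg_left ?_ (by positivity)
  rw [hz]
  have := sq_nonneg ‖S - F‖
  linarith

/-! ### Loss against probability of selection -/

/-- Raise `u ≤ e^u` at `u = a y / p` to the power `p`. -/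
theorem rpow_mul_exp_neg_le {p a y : ℝ} (hp : 0 < p) (ha : 0 < a) (hy : 0 ≤ y) :
    y ^ p * Real.exp (-(a * y)) ≤ (p / a) ^ p := by
  have h : y ≤ p / a * Real.exp (a * y / p) := by
    have := Real.add_one_le_exp (a * y / p)
    calc y = p / a * (a * y / p) := by field_simp
      _ ≤ _ := by gcongr; linarith
  have h2 : y ^ p ≤ (p / a) ^ p * Real.exp (a * y) := by
    calc y ^ p ≤ (p / a * Real.exp (a * y / p)) ^ p := Real.rpow_le_rpow hy h hp.le
      _ = _ := by
        rw [Real.mul_rpow (by positivity) (Real.exp_pos _).le, ← Real.exp_mul]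
        congr 2
        field_simp
  calc _ ≤ (p / a) ^ p * Real.exp (a * y) * Real.exp (-(a * y)) := by gcongr
    _ = _ := by rw [mul_assoc, ← Real.exp_add]; simp

/-- For a candidate far from the oracle `i`, the exponential bound on the probability that it is
selected beats its loss. -/
theorem rpow_mul_exp_criterion_le {A q : ℝ} (hA : 1 ≤ A) (hq : 1 ≤ q)
    (hqA : q < 2 * A / Real.log 2) {n i j : ℕ} (hn : 1 ≤ n) (hi : 1 ≤ i) {d δ R : ℝ}
    (hd : 0 ≤ d) (hδ : 0 ≤ δ) (hδR : δ ≤ R) (hR : (i : ℝ) * 2 ^ i / n ≤ R ^ 2)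
    (hfar : (32 + 1536 * A) * R ^ 2 < d ^ 2) :
    d ^ q * Real.exp (-(n / (12 * 2 ^ (max i j + 1)) * (d ^ 2 / 8 - 2 * δ ^ 2 +
      (192 * A * (j * 2 ^ j / n) - 192 * A * (i * 2 ^ i / n)) / 2))) ≤
      (384 * q) ^ (q / 2) * Real.exp (-(j : ℝ)) * R ^ q := by
  have hn' : (0 : ℝ) < n := by exact_mod_cast hn
  have hi' : (1 : ℝ) ≤ i := by exact_mod_cast hi
  have hR0 : 0 ≤ R := hδ.trans hδR
  set m := max i j with hm
  set M : ℝ := 2 ^ m with hM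
  have hM0 : 0 < M := by positivity
  set y : ℝ := n * d ^ 2 / M with hy
  have hy0 : 0 ≤ y := by positivity
  have hlog : 0 < Real.log 2 := Real.log_pos (by norm_num)
  have hδ2 : δ ^ 2 ≤ R ^ 2 := pow_le_pow_left₀ hδ hδR 2
  have hAm : 0 ≤ A * m := by positivity
  -- If `i ≤ j`, the penalty of `j` pays; if `j ≤ i`, the distance pays, through the `1536 A` in
  -- `hfar`.
  have hpen : 2 * (A * m) ≤ y / 768 + 4 * A * (j * 2 ^ j / M) := by
    rcases le_total i j with h | h
    · have hmj : m = j := max_eq_right h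
      have : (2 : ℝ) ^ j = M := by rw [hM, hmj]
      rw [this, mul_div_assoc, div_self hM0.ne', hmj]
      have : 0 ≤ A * j := by positivity
      linarith
    · have hmi : m = i := max_eq_left h
      have h1 : 1536 * (A * i) ≤ y := by
        rw [hy, le_div_iff₀ hM0, hM, hmi]
        rw [div_le_iff₀ hn'] at hR
        calc 1536 * (A * i) * 2 ^ i = 1536 * A * (i * 2 ^ i) := by ring
          _ ≤ 1536 * A * (R ^ 2 * n) := by gcongr
          _ = n * (1536 * A * R ^ 2) := by ring
          _ ≤ n * d ^ 2 := by
            gcongr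
            nlinarith [sq_nonneg R]
      have : 0 ≤ 4 * A * (j * 2 ^ j / M) := by positivity
      rw [hmi]
      linarith
  have hexp : y / 768 + 2 * (A * m) ≤ n / (12 * 2 ^ (m + 1)) * (d ^ 2 / 8 - 2 * δ ^ 2 +
      (192 * A * (j * 2 ^ j / n) - 192 * A * (i * 2 ^ i / n)) / 2) := by
    -- One sixteenth of the threshold `32 + 1536 A` is `2 + 96 A`: it absorbs `2 δ²` and the penalty
    -- of `i`.
    have h1 : d ^ 2 / 16 + 96 * A * (j * 2 ^ j / n) ≤ d ^ 2 / 8 - 2 * δ ^ 2 +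
      (192 * A * (j * 2 ^ j / n) - 192 * A * (i * 2 ^ i / n)) / 2 := by
      have : 96 * A * (i * 2 ^ i / n) ≤ 96 * A * R ^ 2 := by gcongr
      linarith
    calc y / 768 + 2 * (A * m) ≤ y / 384 + 4 * A * (j * 2 ^ j / M) := by linarith
      _ = n / (12 * 2 ^ (m + 1)) * (d ^ 2 / 16 + 96 * A * (j * 2 ^ j / n)) := by
        rw [pow_succ, ← hM, hy]
        field_simp
        ring
      _ ≤ _ := by gcongr
  have hdq : d ^ q = y ^ (q / 2) * M ^ (q / 2) * (1 / n) ^ (q / 2) := by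
    rw [← Real.mul_rpow hy0 hM0.le, ← Real.mul_rpow (by positivity) (by positivity)]
    have : y * M * (1 / n) = d ^ 2 := by rw [hy]; field_simp
    rw [this, ← Real.rpow_natCast, ← Real.rpow_mul hd]
    congr 1
    push_cast
    ring
  -- The only use of `q < 2 A / log 2`: half of `exp (-2 A m)` cancels this factor, the other half
  -- gives `e^(-j)`.
  have hMq : M ^ (q / 2) ≤ Real.exp (A * m) := by
    rw [Real.rpow_def_of_pos hM0, Real.exp_le_exp, hM, Real.log_pow]
    have : q * Real.log 2 < 2 * A := (lt_div_iff₀ hlog).1 hqA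
    have hm0 : (0 : ℝ) ≤ m := by positivity
    nlinarith
  have hnR : (1 / (n : ℝ)) ^ (q / 2) ≤ R ^ q := by
    have h1 : 1 / (n : ℝ) ≤ R ^ 2 := by
      refine le_trans ?_ hR
      gcongr
      have : (1 : ℝ) ≤ 2 ^ i := one_le_pow₀ (by norm_num)
      nlinarith
    calc (1 / (n : ℝ)) ^ (q / 2) ≤ (R ^ 2) ^ (q / 2) :=
          Real.rpow_le_rpow (by positivity) h1 (by positivity)
      _ = R ^ q := by
        rw [← Real.rpow_natCast, ← Real.rpow_mul hR0]
        congr 1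
        push_cast
        ring
  have hyq : y ^ (q / 2) * Real.exp (-(1 / 768 * y)) ≤ (384 * q) ^ (q / 2) := by
    refine (rpow_mul_exp_neg_le (by positivity) (by norm_num) hy0).trans_eq ?_
    congr 1
    ring
  have hj : (j : ℝ) ≤ A * m := by
    have : (j : ℝ) ≤ m := by exact_mod_cast le_max_right i j
    nlinarith
  calc _ ≤ d ^ q * Real.exp (-(y / 768 + 2 * (A * m))) := by gcongr
    _ = y ^ (q / 2) * Real.exp (-(1 / 768 * y)) * (M ^ (q / 2) * Real.exp (-(2 * (A * m)))) *
        (1 / n) ^ (q / 2) := by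
      rw [hdq, show -(y / 768 + 2 * (A * m)) = -(1 / 768 * y) + -(2 * (A * m)) by ring,
        Real.exp_add]
      ring
    _ ≤ (384 * q) ^ (q / 2) * Real.exp (-(j : ℝ)) * R ^ q := by
      gcongr
      calc M ^ (q / 2) * Real.exp (-(2 * (A * m)))
          ≤ Real.exp (A * m) * Real.exp (-(2 * (A * m))) := by gcongr
        _ = Real.exp (-(A * m)) := by rw [← Real.exp_add]; congr 1; ring
        _ ≤ _ := by gcongr

theorem sum_exp_neg_le_two (n : ℕ) : ∑ j ∈ Finset.Icc 1 n, Real.exp (-(j : ℝ)) ≤ 2 := by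
  calc ∑ j ∈ Finset.Icc 1 n, Real.exp (-(j : ℝ))
      ≤ ∑ j ∈ Finset.Icc 1 n, (1 / (2 : ℝ)) ^ j := by
        refine Finset.sum_le_sum fun j _ => ?_
        have h : Real.exp (-1) ≤ 1 / 2 := by
          rw [Real.exp_neg, one_div]
          exact inv_anti₀ (by norm_num) (by linarith [Real.add_one_le_exp 1])
        calc Real.exp (-(j : ℝ)) = Real.exp (-1) ^ j := by rw [← Real.exp_nat_mul]; simp
          _ ≤ _ := by gcongr
    _ ≤ ∑ j ∈ Finset.range (n + 1), (1 / (2 : ℝ)) ^ j :=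
        Finset.sum_le_sum_of_subset_of_nonneg
          (fun j hj => by simp at hj ⊢; omega) fun _ _ _ => by positivity
    _ ≤ 2 := sum_geometric_two_le _

/-! ### Bounded versions and measurable selection -/

/-- A density bounded almost everywhere has a version bounded everywhere. -/
theorem exists_bounded_version {𝒳 : Type*} [MeasurableSpace 𝒳] {μ : Measure 𝒳}
    [IsProbabilityMeasure μ] {b : ℝ} (hb : 0 ≤ b) {t : 𝒳 →ₘ[μ] ℝ} (ht : t ∈ LbarInfty b μ) :
    ∃ (T : Lp ℝ 2 μ) (f : 𝒳 → ℝ), (T : 𝒳 →ₘ[μ] ℝ) = t ∧ T =ᵐ[μ] f ∧ Measurable f ∧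
      (∀ x, 0 ≤ f x) ∧ (∀ x, f x ≤ b) ∧ ‖T‖ ^ 2 ≤ b := by
  obtain ⟨⟨hLp, h0, h1⟩, hbd⟩ := ht
  have hmem : MemLp t ∞ μ := Lp.mem_Lp_iff_memLp.1 hLp
  have hmem2 : t ∈ Lp ℝ 2 μ := Lp.mem_Lp_iff_memLp.2 (hmem.mono_exponent le_top)
  have hle : ∀ᵐ x ∂μ, t x ≤ b := by
    have h := ae_le_eLpNormEssSup (f := t) (μ := μ)
    rw [eLpNorm_exponent_top] at hbd
    filter_upwards [h] with x hx
    have := hx.trans hbd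
    rw [← ofReal_norm, ENNReal.ofReal_le_ofReal_iff hb] at this
    exact (le_abs_self _).trans this
  have h0' := ae_nonneg_of_nonneg h0
  refine ⟨⟨t, hmem2⟩, fun x => min (max (t x) 0) b, rfl, ?_,
    (t.measurable.max measurable_const).min measurable_const, fun x => by simp [hb],
    fun x => min_le_right _ _, ?_⟩
  · filter_upwards [hle, h0'] with x h2 h3
    change t x = _
    rw [max_eq_left (show (0 : ℝ) ≤ t x from h3), min_eq_left h2]
  · rw [Lp_two_norm_sq_eq]
    have hi : Integrable t μ := hmem.integrable le_top
    calc ∫ x, t x ^ 2 ∂μ ≤ ∫ x, b * t x ∂μ := by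
          refine integral_mono_of_nonneg (.of_forall fun x => sq_nonneg _) (hi.const_mul b) ?_
          filter_upwards [hle, h0'] with x h2 h3
          change t x ^ 2 ≤ b * t x
          rw [sq]
          exact mul_le_mul_of_nonneg_right h2 h3
      _ = b := by rw [integral_const_mul, h1, mul_one]

theorem d2_eq_ofReal_norm {𝒳 : Type*} [MeasurableSpace 𝒳] {μ : Measure 𝒳} (F G : Lp ℝ 2 μ) :
    d2 (F : 𝒳 →ₘ[μ] ℝ) G = ENNReal.ofReal ‖F - G‖ := by
  rw [ofReal_norm, Lp.enorm_def, d2]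
  rfl

/-- A measurable choice of a minimizer in a finite family of criteria. -/
theorem exists_measurable_argmin {Ω : Type*} [MeasurableSpace Ω] {n : ℕ} (hn : 1 ≤ n)
    {c : ℕ → Ω → ℝ} (hc : ∀ j ∈ Finset.Icc 1 n, Measurable (c j)) :
    ∃ J : Ω → ℕ, Measurable J ∧ (∀ x, J x ∈ Finset.Icc 1 n) ∧
      ∀ x, ∀ i ∈ Finset.Icc 1 n, c (J x) x ≤ c i x := by
  classical
  have h : ∀ x, ∃ j, j ∈ Finset.Icc 1 n ∧ ∀ i ∈ Finset.Icc 1 n, c j x ≤ c i x := fun x =>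
    Finset.exists_min_image _ (fun j => c j x) ⟨1, by simp [hn]⟩
  refine ⟨fun x => Nat.find (h x), measurable_find h fun j => ?_,
    fun x => (Nat.find_spec (h x)).1, fun x => (Nat.find_spec (h x)).2⟩
  by_cases hj : j ∈ Finset.Icc 1 n
  · have : {x | j ∈ Finset.Icc 1 n ∧ ∀ i ∈ Finset.Icc 1 n, c j x ≤ c i x} =
        ⋂ i ∈ Finset.Icc 1 n, {x | c j x ≤ c i x} := by
      ext x
      simp only [Set.mem_ofPred_eq, Set.mem_iInter]
      exact ⟨fun h => h.2, fun h => ⟨hj, h⟩⟩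
    rw [this]
    exact Finset.measurableSet_biInter _ fun i hi => measurableSet_le (hc j hj) (hc i hi)
  · simp [hj]

/-! ### The oracle inequality for indices up to `n` -/

/-- The penalized least squares criterion of a candidate `F` with version `f`. -/
noncomputable def penalizedCriterion {𝒳 : Type*} [MeasurableSpace 𝒳] {μ : Measure 𝒳} {n : ℕ}
    (A : ℝ) (T : ℕ → Lp ℝ 2 μ) (f : ℕ → 𝒳 → ℝ) (j : ℕ) (x : Fin n → 𝒳) : ℝ :=
  ‖T j‖ ^ 2 - 2 / n * ∑ k, f j (x k) + 192 * A * (j * 2 ^ j / n)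

/-- The constant in the oracle inequality for the candidates with index at most `n`. -/
noncomputable def oracleConst (A q : ℝ) : ℝ :=
  (1 + √(32 + 1536 * A)) ^ q + 2 * (2 ^ q * (384 * q) ^ (q / 2))

/-- If the selected candidate is near `T i`, the triangle inequality gives a multiple of `R`. If it
is far, its loss is at most twice its distance to `T i`, and a union bound over `j` sums the
pairwise estimates. -/
theorem lintegral_argmin_le {𝒳 : Type*} [MeasurableSpace 𝒳] {μ : Measure 𝒳}
    [IsProbabilityMeasure μ] {n : ℕ} (hn : 1 ≤ n) {T : ℕ → Lp ℝ 2 μ} {f : ℕ → 𝒳 → ℝ}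
    (hTf : ∀ j, 1 ≤ j → T j =ᵐ[μ] f j) (hf : ∀ j, 1 ≤ j → Measurable (f j))
    (hf0 : ∀ j, 1 ≤ j → ∀ x, 0 ≤ f j x) (hfb : ∀ j, 1 ≤ j → ∀ x, f j x ≤ 2 ^ (j + 1))
    {A q : ℝ} (hA : 1 ≤ A) (hq : 1 ≤ q) (hqA : q < 2 * A / Real.log 2)
    {J : (Fin n → 𝒳) → ℕ} (hJ : ∀ x, J x ∈ Finset.Icc 1 n)
    (hmin : ∀ x, ∀ i ∈ Finset.Icc 1 n,
      penalizedCriterion A T f (J x) x ≤ penalizedCriterion A T f i x)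
    {S : Lp ℝ 2 μ} (hS : (S : 𝒳 →ₘ[μ] ℝ) ∈ Lbar 2 μ) {i : ℕ} (hi : i ∈ Finset.Icc 1 n) {R : ℝ}
    (hδR : ‖S - T i‖ ≤ R) (hR : (i : ℝ) * 2 ^ i / n ≤ R ^ 2) :
    ∫⁻ x, ENNReal.ofReal ‖T (J x) - S‖ ^ q ∂(sampleLaw n (S : 𝒳 →ₘ[μ] ℝ)) ≤
      ENNReal.ofReal (oracleConst A q * R ^ q) := by
  have := isProbabilityMeasure_densityLaw hS
  have : IsProbabilityMeasure (sampleLaw n (S : 𝒳 →ₘ[μ] ℝ)) := by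
    unfold sampleLaw; infer_instance
  have hq0 : 0 ≤ q := by linarith
  have hi1 := (Finset.mem_Icc.1 hi).1
  have hR0 : 0 ≤ R := (norm_nonneg _).trans hδR
  have hA0 : 0 ≤ 32 + 1536 * A := by linarith
  set c₀ : ℝ := (1 + √(32 + 1536 * A)) ^ q with hc₀
  set E : ℕ → Set (Fin n → 𝒳) := fun j =>
    {x | penalizedCriterion A T f j x ≤ penalizedCriterion A T f i x} with hE
  set w : ℕ → ℝ := fun j =>
    if (32 + 1536 * A) * R ^ 2 < ‖T j - T i‖ ^ 2 then (2 * ‖T j - T i‖) ^ q else 0 with hw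
  have hw0 : ∀ j, 0 ≤ w j := fun j => by
    simp only [hw]
    split_ifs <;> positivity
  have hEm : ∀ j ∈ Finset.Icc 1 n, MeasurableSet (E j) := fun j hj => by
    have h1 := hf j (Finset.mem_Icc.1 hj).1
    have h2 := hf i hi1
    refine measurableSet_le ?_ ?_ <;> unfold penalizedCriterion <;> fun_prop
  have hprob : ∀ j ∈ Finset.Icc 1 n,
      ENNReal.ofReal (w j) * sampleLaw n (S : 𝒳 →ₘ[μ] ℝ) (E j) ≤
        ENNReal.ofReal (2 ^ q * (384 * q) ^ (q / 2) * R ^ q * Real.exp (-(j : ℝ))) := by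
    intro j hj
    have hj1 := (Finset.mem_Icc.1 hj).1
    rw [← ofReal_measureReal, ← ENNReal.ofReal_mul (hw0 j)]
    refine ENNReal.ofReal_le_ofReal ?_
    by_cases hfar : (32 + 1536 * A) * R ^ 2 < ‖T j - T i‖ ^ 2
    · have h1 := sampleLaw_criterion_le_criterion hS (hf i hi1) (hf j hj1) (hTf i hi1)
        (hTf j hj1) (b := 2 ^ (max i j + 1)) (by positivity) (hf0 i hi1)
        (fun x => (hfb i hi1 x).trans (by gcongr; exacts [by norm_num, le_max_left _ _]))
        (hf0 j hj1)
        (fun x => (hfb j hj1 x).trans (by gcongr; exacts [by norm_num, le_max_right _ _])) hn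
        (192 * A * (j * 2 ^ j / n) - 192 * A * (i * 2 ^ i / n))
      have h2 := rpow_mul_exp_criterion_le hA hq hqA (j := j) hn hi1 (norm_nonneg (T j - T i))
        (norm_nonneg (S - T i)) hδR hR hfar
      have hset : E j = {x | ‖T j‖ ^ 2 - 2 / n * ∑ k, f j (x k) +
          (192 * A * (j * 2 ^ j / n) - 192 * A * (i * 2 ^ i / n)) ≤
          ‖T i‖ ^ 2 - 2 / n * ∑ k, f i (x k)} := by
        ext x
        simp only [hE, penalizedCriterion, Set.mem_ofPred_eq]
        constructor <;> intro h <;> linarith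
      rw [← hset] at h1
      simp only [hw, if_pos hfar]
      rw [Real.mul_rpow (by norm_num) (norm_nonneg _)]
      calc 2 ^ q * ‖T j - T i‖ ^ q * (sampleLaw n (S : 𝒳 →ₘ[μ] ℝ)).real (E j)
          ≤ 2 ^ q * (‖T j - T i‖ ^ q * _) := by
            rw [mul_assoc]
            gcongr
        _ ≤ 2 ^ q * ((384 * q) ^ (q / 2) * Real.exp (-(j : ℝ)) * R ^ q) :=
            mul_le_mul_of_nonneg_left h2 (by positivity)
        _ = _ := by ring
    · simp only [hw, if_neg hfar, zero_mul]
      positivity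
  have hpt : ∀ x, ENNReal.ofReal ‖T (J x) - S‖ ^ q ≤ ENNReal.ofReal (c₀ * R ^ q) +
      ∑ j ∈ Finset.Icc 1 n, (E j).indicator (fun _ => ENNReal.ofReal (w j)) x := by
    intro x
    rw [ENNReal.ofReal_rpow_of_nonneg (norm_nonneg _) hq0]
    have htri : ‖T (J x) - S‖ ≤ ‖T (J x) - T i‖ + ‖S - T i‖ := by
      rw [norm_sub_rev S]
      exact norm_sub_le_norm_sub_add_norm_sub _ _ _
    by_cases hfar : (32 + 1536 * A) * R ^ 2 < ‖T (J x) - T i‖ ^ 2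
    · have hx : x ∈ E (J x) := hmin x i hi
      refine le_trans ?_ le_add_self
      refine le_trans ?_ (Finset.single_le_sum (fun _ _ => zero_le) (hJ x))
      rw [Set.indicator_of_mem hx]
      simp only [hw, if_pos hfar]
      refine ENNReal.ofReal_le_ofReal (Real.rpow_le_rpow (norm_nonneg _) ?_ hq0)
      have : R ≤ ‖T (J x) - T i‖ :=
        le_of_sq_le_sq (by nlinarith [sq_nonneg R]) (norm_nonneg _)
      linarith
    · refine le_trans ?_ le_self_add
      rw [hc₀, ← Real.mul_rpow (by positivity) hR0]
      refine ENNReal.ofReal_le_ofReal (Real.rpow_le_rpow (norm_nonneg _) ?_ hq0)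
      have : ‖T (J x) - T i‖ ≤ √(32 + 1536 * A) * R := by
        refine le_of_sq_le_sq ?_ (by positivity)
        rw [mul_pow, Real.sq_sqrt hA0]
        exact not_lt.1 hfar
      linarith
  calc _ ≤ ∫⁻ x, (ENNReal.ofReal (c₀ * R ^ q) +
        ∑ j ∈ Finset.Icc 1 n, (E j).indicator (fun _ => ENNReal.ofReal (w j)) x)
          ∂(sampleLaw n (S : 𝒳 →ₘ[μ] ℝ)) := lintegral_mono hpt
    _ = ENNReal.ofReal (c₀ * R ^ q) +
        ∑ j ∈ Finset.Icc 1 n, ENNReal.ofReal (w j) * sampleLaw n (S : 𝒳 →ₘ[μ] ℝ) (E j) := by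
      rw [lintegral_add_left measurable_const, lintegral_const, measure_univ, mul_one,
        lintegral_finsetSum' _ fun j hj => (measurable_const.indicator (hEm j hj)).aemeasurable]
      congr 1
      exact Finset.sum_congr rfl fun j hj => lintegral_indicator_const (hEm j hj) _
    _ ≤ ENNReal.ofReal (c₀ * R ^ q) + ∑ j ∈ Finset.Icc 1 n,
        ENNReal.ofReal (2 ^ q * (384 * q) ^ (q / 2) * R ^ q * Real.exp (-(j : ℝ))) := by
      gcongr with j hj
      exact hprob j hj
    _ ≤ _ := by
      rw [← ENNReal.ofReal_sum_of_nonneg fun j _ => by positivity,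
        ← ENNReal.ofReal_add (by positivity) (Finset.sum_nonneg fun j _ => by positivity),
        ← Finset.mul_sum]
      refine ENNReal.ofReal_le_ofReal ?_
      calc _ ≤ c₀ * R ^ q + 2 ^ q * (384 * q) ^ (q / 2) * R ^ q * 2 := by
            gcongr
            exact sum_exp_neg_le_two n
        _ = _ := by rw [oracleConst]; ring

/-! ### The main theorem -/

theorem mainTheorem6 :
    ∃ C : ℝ → ℝ → ℝ≥0,
      ∀ (𝒳 : Type u) [MeasurableSpace 𝒳] (μ : Measure 𝒳) [IsProbabilityMeasure μ]
        (n : ℕ), 1 ≤ n →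
      ∀ t : ℕ → (𝒳 →ₘ[μ] ℝ), (∀ i : ℕ, 1 ≤ i → t i ∈ LbarInfty ((2 : ℝ) ^ (i + 1)) μ) →
      ∀ A : ℝ, 1 ≤ A →
      ∃ shat : (Fin n → 𝒳) → Lp ℝ 2 μ, StronglyMeasurable shat ∧
        ∀ s ∈ Lbar 2 μ, ∀ q : ℝ, 1 ≤ q → q < 2 * A / Real.log 2 →
          risk q shat s ≤
            (C A q : ℝ≥0∞) * ⨅ (i : ℕ) (_ : 1 ≤ i),
              (max (d2 s (t i)) (ENNReal.ofReal √((i : ℝ) * (2 : ℝ) ^ i / (n : ℝ)))) ^ q := by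
  refine ⟨fun A q => (oracleConst A q * 5 ^ q).toNNReal, ?_⟩
  intro 𝒳 _ μ _ n hn t ht A hA
  have hn' : (0 : ℝ) < n := by exact_mod_cast hn
  have hrep : ∀ j, ∃ (T : Lp ℝ 2 μ) (f : 𝒳 → ℝ), 1 ≤ j → (T : 𝒳 →ₘ[μ] ℝ) = t j ∧
      T =ᵐ[μ] f ∧ Measurable f ∧ (∀ x, 0 ≤ f x) ∧ (∀ x, f x ≤ 2 ^ (j + 1)) ∧
      ‖T‖ ^ 2 ≤ 2 ^ (j + 1) := by
    intro j
    by_cases hj : 1 ≤ j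
    · obtain ⟨T, f, h⟩ := exists_bounded_version (by positivity) (ht j hj)
      exact ⟨T, f, fun _ => h⟩
    -- Index `0` gets a dummy candidate, which is never selected.
    · exact ⟨0, 0, fun h => absurd h hj⟩
  choose T f h using hrep
  obtain ⟨J, hJm, hJ, hmin⟩ := exists_measurable_argmin (Ω := Fin n → 𝒳)
    (c := penalizedCriterion A T f) hn fun j hj => by
      have := (h j (Finset.mem_Icc.1 hj).1).2.2.1
      unfold penalizedCriterion
      fun_prop
  refine ⟨fun x => T (J x), (StronglyMeasurable.of_discrete (f := T)).comp_measurable hJm, ?_⟩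
  intro s hs q hq hqA
  obtain ⟨S, rfl⟩ : ∃ S : Lp ℝ 2 μ, (S : 𝒳 →ₘ[μ] ℝ) = s := ⟨⟨s, hs.1⟩, rfl⟩
  have hq0 : 0 ≤ q := by linarith
  have hC : 0 < oracleConst A q := by
    unfold oracleConst
    positivity
  set r : ℕ → ℝ := fun i => max ‖S - T i‖ √((i : ℝ) * 2 ^ i / n) with hr
  have hr0 : ∀ i, 0 ≤ r i := fun i => (norm_nonneg _).trans (le_max_left _ _)
  have hin : ∀ i ∈ Finset.Icc 1 n, risk q (fun x => T (J x)) (S : 𝒳 →ₘ[μ] ℝ) ≤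
      ENNReal.ofReal (oracleConst A q * r i ^ q) := by
    intro i hi
    simp only [risk, d2_eq_ofReal_norm]
    refine lintegral_argmin_le hn (fun j hj => (h j hj).2.1) (fun j hj => (h j hj).2.2.1)
      (fun j hj => (h j hj).2.2.2.1) (fun j hj => (h j hj).2.2.2.2.1) hA hq hqA hJ hmin hs
      hi (le_max_left _ _) ?_
    rw [← Real.sq_sqrt (show 0 ≤ (i : ℝ) * 2 ^ i / n by positivity)]
    exact pow_le_pow_left₀ (Real.sqrt_nonneg _) (le_max_right _ _) 2
  -- For `i > n`, `‖T 1‖` and `‖T i‖` are each at most `2ρ`, whence `5 = 1 + 2 + 2`.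
  have hout : ∀ i, n < i → r 1 ≤ 5 * r i := by
    intro i hi
    have hi1 : 1 ≤ i := by omega
    set ρ := √((i : ℝ) * 2 ^ i / n) with hρ
    have hρ0 : 0 ≤ ρ := Real.sqrt_nonneg _
    have hpow : (2 : ℝ) ≤ 2 ^ i := by simpa using pow_le_pow_right₀ (one_le_two (α := ℝ)) hi1
    have hρ2 : (2 : ℝ) ^ i ≤ ρ ^ 2 := by
      rw [hρ, Real.sq_sqrt (by positivity), le_div_iff₀ hn', mul_comm]
      gcongr
    have h1 : ‖T 1‖ ≤ 2 * ρ := by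
      refine le_of_sq_le_sq ?_ (by positivity)
      have := (h 1 le_rfl).2.2.2.2.2
      norm_num at this
      nlinarith
    have h2 : ‖T i‖ ≤ 2 * ρ := by
      refine le_of_sq_le_sq ?_ (by positivity)
      have := (h i hi1).2.2.2.2.2
      rw [pow_succ (2 : ℝ)] at this
      nlinarith
    have h3 : ‖S - T 1‖ ≤ ‖S - T i‖ + ‖T i‖ + ‖T 1‖ := by
      calc ‖S - T 1‖ ≤ ‖S - T i‖ + ‖T i - T 1‖ := norm_sub_le_norm_sub_add_norm_sub _ _ _
        _ ≤ _ := by linarith [norm_sub_le (T i) (T 1)]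
    have h4 : ‖S - T i‖ ≤ r i := le_max_left _ _
    have h5 : ρ ≤ r i := le_max_right _ _
    refine max_le (by linarith) ?_
    have h6 : √(((1 : ℕ) : ℝ) * 2 ^ 1 / n) ≤ ρ := by
      refine Real.sqrt_le_sqrt ?_
      have : (1 : ℝ) ≤ i := by exact_mod_cast hi1
      gcongr
      · norm_num
    linarith
  have hall : ∀ i, 1 ≤ i → risk q (fun x => T (J x)) (S : 𝒳 →ₘ[μ] ℝ) ≤
      ENNReal.ofReal (oracleConst A q * 5 ^ q * r i ^ q) := by
    intro i hi
    rw [mul_assoc, ← Real.mul_rpow (by norm_num) (hr0 i)]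
    rcases le_or_gt i n with hin' | hin'
    · refine (hin i (Finset.mem_Icc.2 ⟨hi, hin'⟩)).trans (ENNReal.ofReal_le_ofReal ?_)
      gcongr
      linarith [hr0 i]
    · refine (hin 1 (Finset.mem_Icc.2 ⟨le_rfl, hn⟩)).trans (ENNReal.ofReal_le_ofReal ?_)
      gcongr
      exact hout i hin'
  have hCpos : 0 < oracleConst A q * 5 ^ q := by positivity
  have hC0 : ((oracleConst A q * 5 ^ q).toNNReal : ℝ≥0∞) ≠ 0 := by simpa using hCpos
  simp only [ENNReal.mul_iInf_of_ne hC0 ENNReal.coe_ne_top]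
  refine le_iInf₂ fun i hi => (hall i hi).trans_eq ?_
  rw [← (h i hi).1, d2_eq_ofReal_norm, ← ENNReal.ofReal_max,
    ENNReal.ofReal_rpow_of_nonneg (hr0 i) hq0, ENNReal.ofReal_mul hCpos.le]
  rfl
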